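/- Let $\mathbb{F}_q$ be a finite field with $q$ elements, let $n,m$ be non-negative integers, and write $\mathbb{F}_q^{n\times m}$ for the set of $n\times m$ matrices over $\mathbb{F}_q$, $\mathbb{F}_q^{n\times m,r}$ for the set of those of rank $r$, and $\mathrm{row}(M)\subseteq\mathbb{F}_q^m$ for the row space of $M$. Let $\mathcal{R}$ be a probability distribution on $\{0,1,\dots,\min\{n,m\}\}$. The Gamma channel $\Gamma(\mathcal{R})$ has input and output set $\mathbb{F}_q^{n\times m}$ and channel law $\boldsymbol{Y}=\boldsymbol{A}(\boldsymbol{X}+\boldsymbol{B})$, where $\boldsymbol{A}$ and $\boldsymbol{B}$ are independent of each other and of the input $\boldsymbol{X}$, $\boldsymbol{A}$ is uniform on $\mathrm{GL}(n,q)$, and $\boldsymbol{B}$ takes each value $M$ with probability $\mathcal{R}(\mathrm{rank}\,M)/|\mathbb{F}_q^{n\times m,\mathrm{rank}\,M}|$. Its capacity is $C=\max_{\mathcal{P}_{\boldsymbol X}} I(\boldsymbol{X};\boldsymbol{Y})$, over all probability distributions $\mathcal{P}_{\boldsymbol X}$ of the input $\boldsymbol X$ on $\mathbb{F}_q^{n\times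 m}$. Logarithms are to any fixed base $b>1$, and terms with weight $0$ are read as $0$ (so $0\log 0=0$ and $0\log(c/0)=0$). The following numbers depend only on $q,n,m$ and the displayed arguments: * $f_0(u)$, the number of $M\in\mathbb{F}_q^{n\times m}$ with $\mathrm{row}(M)=U$, where $U$ is a fixed subspace of $\mathbb{F}_q^m$ of dimension $u$; * $f_1(u,v,h;r)$, the number of $B\in\mathbb{F}_q^{n\times m,r}$ with $\mathrm{row}(M+B)=V$, where $M\in\mathbb{F}_q^{n\times m}$ is a fixed matrix of rank $u$ and $V$ a fixed subspace of $\mathbb{F}_q^m$ of dimension $v$ with $\dim\big((\mathrm{row}(M)+V)/V\big)=h$; * $f_2(r,r_X,r_B)$, the number of $B\in\mathbb{F}_q^{n\times m,r_B}$ with $\mathrm{rank}(X+B)=r$, where $X\in\mathbb{F}_q^{n\times m}$ is a fixed matrix of rank $r_X$ (each is set to $0$ for arguments for which there is no such configuration). Let $\left[{a\atop d}\right]_q=\prod_{i=0}^{d-1}\frac{q^a-q^i}{q^d-q^i}$ for $0\le d\le a$, and $\left[{a\atop d}\right]_q=0$ for all other integers $d$. For a probability distribution $\mathcal{R}_{\boldsymbol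 X}$ on $\{0,\dots,\min\{n,m\}\}$ put $$\sigma(r_Y)=\sum_{r_X,r_B=0}^{\min\{n,m\}}\mathcal{R}_{\boldsymbol X}(r_X)\,\mathcal{R}(r_B)\,\frac{f_2(r_Y,r_X,r_B)}{|\mathbb{F}_q^{n\times m,r_B}|},\qquad \pi(r,u,h)=\sum_{r_B=0}^{\min\{n,m\}}\mathcal{R}(r_B)\,\frac{f_1(r,u,h;r_B)}{|\mathbb{F}_q^{n\times m,r_B}|}.$$ Then the maximum that defines $C$ is attained, and $$C=\max_{\mathcal{R}_{\boldsymbol X}}\left\{-\sum_{r_Y=0}^{\min\{n,m\}}\sigma(r_Y)\log\left(\frac{\sigma(r_Y)}{|\mathbb{F}_q^{n\times m,r_Y}|}\right)-\sum_{r=0}^{\min\{n,m\}}\mathcal{R}_{\boldsymbol X}(r)\sum_{u=0}^{\min\{n,m\}}\sum_{h=0}^{r}q^{(u-r+h)h}\left[{m-r\atop u-r+h}\right]_q\left[{r\atop r-h}\right]_q\pi(r,u,h)\log\left(\frac{f_0(u)}{\pi(r,u,h)}\right)\right\},$$ where the maximum is over all probability distributions $\mathcal{R}_{\boldsymbol X}$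 on $\{0,\dots,\min\{n,m\}\}$ and is attained. -/

import Mathlib

noncomputable section

namespace GammaChannel

theorem rank_lt {F : Type*} [Field F] {n m : ℕ} (M : Matrix (Fin n) (Fin m) F) :
    M.rank < min n m + 1 :=
  Nat.lt_succ_of_le (le_min M.rank_le_height M.rank_le_width)

variable (F : Type*) [Field F] [Fintype F] [DecidableEq F] (n m : ℕ)

/-- The row space of a matrix. -/
def rowSpace {F : Type*} [Field F] {n m : ℕ} (M : Matrix (Fin n) (Fin m) F) :
    Submodule F (Fin m → F) :=
  Submodule.span F (Set.range M.row)

/-- The number of `n × m` matrices over `F` of rank `r`. -/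
def numRank (r : ℕ) : ℕ :=
  Nat.card {M : Matrix (Fin n) (Fin m) F // M.rank = r}

/-- The set of probability distributions on `{0, 1, …, min n m}`, the possible ranks. -/
def rankDists : Set (Fin (min n m + 1) → ℝ) := stdSimplex ℝ (Fin (min n m + 1))

variable {F n m}

/-- The uniform-given-rank distribution on matrices with rank distribution `R`:
a matrix `M` has probability `R(rank M)` divided by the number of matrices of that rank. -/
def ugr (R : Fin (min n m + 1) → ℝ) (M : Matrix (Fin n) (Fin m) F) : ℝ :=
  R ⟨M.rank, rank_lt M⟩ / numRank F n m M.rank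

/-- The law of the Gamma channel with rank error distribution `R`: `channelLaw R X Y` is the
probability that `A (X + B) = Y`, where `A` is uniform on `GL(n, F)`, `B` is
uniform given rank with rank distribution `R`, and `A`, `B` are independent. -/
def channelLaw (R : Fin (min n m + 1) → ℝ) (X Y : Matrix (Fin n) (Fin m) F) : ℝ :=
  ∑ A : GL (Fin n) F, ∑ B : Matrix (Fin n) (Fin m) F,
    (1 / (Fintype.card (GL (Fin n) F) : ℝ)) * ugr R B *
      (if (A : Matrix (Fin n) (Fin n) F) * (X + B) = Y then 1 else 0)

/-- The distribution of the channel output `Y` when the input has distribution `P`. -/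
def outputDist (R : Fin (min n m + 1) → ℝ) (P : Matrix (Fin n) (Fin m) F → ℝ)
    (Y : Matrix (Fin n) (Fin m) F) : ℝ :=
  ∑ X, P X * channelLaw R X Y

/-- The mutual information `I(X; Y)`, with logarithms to base `b`, of the input and the output
of the Gamma channel when the input has distribution `P`:
`∑ p(x, y) log (p(x, y) / (p(x) p(y)))`, where terms with `p(x, y) = 0` vanish. -/
def mutualInfo (b : ℝ) (R : Fin (min n m + 1) → ℝ) (P : Matrix (Fin n) (Fin m) F → ℝ) : ℝ :=
  ∑ X, ∑ Y, (P X * channelLaw R X Y) *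
    Real.logb b ((P X * channelLaw R X Y) / (P X * outputDist R P Y))

variable (F n m)

/-- The values of the mutual information over all input distributions on the matrices. -/
def mutualInfoValues (b : ℝ) (R : Fin (min n m + 1) → ℝ) : Set ℝ :=
  mutualInfo (F := F) b R '' stdSimplex ℝ (Matrix (Fin n) (Fin m) F)

/-- The capacity of the Gamma channel: the supremum of the mutual information over all
input distributions (that it is a maximum is a part of the theorem). -/
def capacity (b : ℝ) (R : Fin (min n m + 1) → ℝ) : ℝ :=
  sSup (mutualInfoValues F n m b R)

/-! ### Counting functions -/

/-- The number of `n × m` matrices with row space `U`. -/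
def count0 (U : Submodule F (Fin m → F)) : ℕ :=
  Nat.card {M : Matrix (Fin n) (Fin m) F // rowSpace M = U}

/-- The number of `n × m` matrices `B` of rank `r` such that `M + B` has row space `V`. -/
def count1 (M : Matrix (Fin n) (Fin m) F) (V : Submodule F (Fin m → F)) (r : ℕ) : ℕ :=
  Nat.card {B : Matrix (Fin n) (Fin m) F // B.rank = r ∧ rowSpace (M + B) = V}

/-- The number of `n × m` matrices `B` of rank `rB` such that `X + B` has rank `r`. -/
def count2 (X : Matrix (Fin n) (Fin m) F) (r rB : ℕ) : ℕ :=
  Nat.card {B : Matrix (Fin n) (Fin m) F // B.rank = rB ∧ (X + B).rank = r}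

/-- The dimension of `(U + V) / V`, the image of `U` in the quotient by `V`. -/
def quotDim {F : Type*} [Field F] {m : ℕ} (U V : Submodule F (Fin m → F)) : ℕ :=
  Module.finrank F (U.map V.mkQ)

open Classical in
/-- `f0 u` is the number of matrices whose row space is a given subspace of dimension `u`
(any one; the value is `0` if there is no such subspace). -/
def f0 (u : ℕ) : ℕ :=
  if h : ∃ U : Submodule F (Fin m → F), Module.finrank F U = u then
    count0 F n m h.choose
  else 0

open Classical in
/-- `f1 u v h r` is the number of matrices `B` of rank `r` such that `M + B` has row space `V`,
for a given matrix `M` of rank `u` and a given subspace `V` of dimension `v` for which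
`(row(M) + V) / V` has dimension `h` (any such pair; the value is `0` if there is none). -/
def f1 (u v h r : ℕ) : ℕ :=
  if hp : ∃ p : Matrix (Fin n) (Fin m) F × Submodule F (Fin m → F),
      Module.finrank F (rowSpace p.1) = u ∧ Module.finrank F p.2 = v ∧
        quotDim (rowSpace p.1) p.2 = h then
    count1 F n m hp.choose.1 hp.choose.2 r
  else 0

open Classical in
/-- `f2 r rX rB` is the number of matrices `B` of rank `rB` such that `X + B` has rank `r`,
for a given matrix `X` of rank `rX` (any one; the value is `0` if there is none). -/
def f2 (r rX rB : ℕ) : ℕ :=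
  if h : ∃ X : Matrix (Fin n) (Fin m) F, X.rank = rX then
    count2 F n m h.choose r rB
  else 0

/-! ### The objective function -/

/-- The Gaussian binomial coefficient `[a choose d]_q`; it is `0` unless `0 ≤ d ≤ a`. -/
def gaussBinom (q : ℝ) (a : ℕ) (d : ℤ) : ℝ :=
  if 0 ≤ d ∧ d ≤ a then ∏ i ∈ Finset.range d.toNat, (q ^ a - q ^ i) / (q ^ d.toNat - q ^ i)
  else 0

/-- `∑_{r_X, r_B} R_X(r_X) R(r_B) f2(r_Y, r_X, r_B) / #{matrices of rank r_B}`. -/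
def outRank (R RX : Fin (min n m + 1) → ℝ) (rY : ℕ) : ℝ :=
  ∑ rX : Fin (min n m + 1), ∑ rB : Fin (min n m + 1),
    RX rX * R rB * ((f2 F n m rY rX rB : ℝ) / (numRank F n m rB : ℝ))

/-- `∑_{r_B} R(r_B) f1(r, u, h; r_B) / #{matrices of rank r_B}`. -/
def rowProb (R : Fin (min n m + 1) → ℝ) (r u h : ℕ) : ℝ :=
  ∑ rB : Fin (min n m + 1), R rB * ((f1 F n m r u h rB : ℝ) / (numRank F n m rB : ℝ))

/-- The function of the input rank distribution `RX` that is maximised, with logarithms to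
base `b`. As `Real.logb b 0 = 0`, the terms with weight `0` vanish. The integer power has a
negative exponent only where the Gaussian binomial coefficient next to it is `0`. -/
def objective (b : ℝ) (R RX : Fin (min n m + 1) → ℝ) : ℝ :=
  -(∑ rY ∈ Finset.range (min n m + 1),
      outRank F n m R RX rY *
        Real.logb b (1 / (numRank F n m rY : ℝ) * outRank F n m R RX rY))
  - ∑ r : Fin (min n m + 1), RX r *
      ∑ u ∈ Finset.range (min n m + 1), ∑ h ∈ Finset.range ((r : ℕ) + 1),
        (Fintype.card F : ℝ) ^ (((u : ℤ) - (r : ℕ) + h) * h) *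
          gaussBinom (Fintype.card F) (m - (r : ℕ)) ((u : ℤ) - (r : ℕ) + h) *
          gaussBinom (Fintype.card F) r (((r : ℕ) : ℤ) - h) *
          (rowProb F n m R r u h *
            Real.logb b ((f0 F n m u : ℝ) / rowProb F n m R r u h))

end GammaChannel

end

/-!
The group `GL(n, F) × GL(F^m)` acts on matrices, transitively on those of a given rank, and the
uniform-given-rank noise is invariant under it, so that all counting functions are well defined.
The conditional law of `Y` given `X = x` is constant on the matrices with a given row space, and
the entropy `H(Y | X = x)` depends on the rank of `x` only; the Gaussian binomials of the objective
count the subspaces `V` of dimension `u` with `dim ((row x + V) / V) = h`. By concavity of entropy,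
`H(Y)` is at most its value for the law that is uniform given rank, with the same rank distribution
as `Y`. Hence `I(X; Y)` is at most the objective at the rank distribution of `X`, with equality
when `X` is uniform given its rank. The objective is continuous on a compact simplex.
-/

noncomputable section

namespace GammaChannel

open Module

section LinearAlgebra

variable {K V E : Type*} [Field K] [AddCommGroup V] [Module K V] [AddCommGroup E] [Module K E]

theorem exists_disjoint_sup_eq {U V : Submodule K E} (h : U ≤ V) :
    ∃ W, Disjoint U W ∧ U ⊔ W = V := by
  obtain ⟨C, hC⟩ := exists_isCompl U
  refine ⟨C ⊓ V, hC.disjoint.mono_right inf_le_left, ?_⟩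
  rw [← sup_inf_assoc_of_le C h, hC.sup_eq_top, top_inf_eq]

theorem exists_iSupIndep_sup_eq (U V : Submodule K E) :
    ∃ W : Fin 3 → Submodule K E,
      iSupIndep W ∧ W 0 = U ⊓ V ∧ W 0 ⊔ W 1 = U ∧ W 0 ⊔ W 2 = V := by
  obtain ⟨A, hA, hAU⟩ := exists_disjoint_sup_eq (inf_le_left : U ⊓ V ≤ U)
  obtain ⟨B, hB, hBV⟩ := exists_disjoint_sup_eq (inf_le_right : U ⊓ V ≤ V)
  have hUB : Disjoint U B := by
    have hBle : B ≤ V := le_sup_right.trans hBV.le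
    rw [disjoint_iff_inf_le]
    exact (le_inf (inf_le_inf_left U hBle) inf_le_right).trans hB.le_bot
  refine ⟨![U ⊓ V, A, B], ?_, rfl, hAU, hBV⟩
  have huniv : (Finset.univ : Finset (Fin 3)) = {2, 1, 0} := by decide
  rw [iSupIndep_iff_supIndep_univ, huniv]
  refine ((Finset.supIndep_singleton 0 _).insert ?_).insert ?_
  · rw [Finset.sup_singleton]
    exact hA.symm
  · rw [Finset.sup_insert, Finset.sup_singleton]
    exact (hUB.mono_left ((sup_comm _ _).trans hAU).le).symm

theorem map_eq_map_iff (φ : E ≃ₗ[K] E) {U V : Submodule K E} :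
    U.map φ.toLinearMap = V.map φ.toLinearMap ↔ U = V :=
  (Submodule.map_injective_of_injective φ.injective).eq_iff

variable [FiniteDimensional K E]

theorem exists_linearEquiv_comp_eq_of_ker_eq {f g : V →ₗ[K] E} (h : f.ker = g.ker) :
    ∃ φ : E ≃ₗ[K] E, φ.toLinearMap ∘ₗ f = g := by
  obtain ⟨φ, hφ⟩ := Submodule.exists_linearEquiv_restrict_eq
    (f.quotKerEquivRange.symm ≪≫ₗ Submodule.quotEquivOfEq _ _ h ≪≫ₗ g.quotKerEquivRange)
  refine ⟨φ, LinearMap.ext fun x => ?_⟩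
  have hfx : f.quotKerEquivRange.symm ⟨f x, f.mem_range_self x⟩ = f.ker.mkQ x :=
    f.quotKerEquivRange_symm_apply_image x (f.mem_range_self x)
  simpa [hfx] using (hφ ⟨f x, f.mem_range_self x⟩).symm

theorem exists_linearEquiv_map_eq_of_iSupIndep {ι : Type*} {U U' : ι → Submodule K E}
    (hU : iSupIndep U) (hU' : iSupIndep U') (h : ∀ i, finrank K (U i) = finrank K (U' i)) :
    ∃ φ : E ≃ₗ[K] E, ∀ i, (U i).map φ.toLinearMap = U' i := by
  classical
  let e i : U i ≃ₗ[K] U' i := LinearEquiv.ofFinrankEq _ _ (h i)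
  let f : (Π₀ i, U i) →ₗ[K] E := DFinsupp.lsum ℕ fun i => (U i).subtype
  let g : (Π₀ i, U i) →ₗ[K] E :=
    (DFinsupp.lsum ℕ fun i => (U' i).subtype) ∘ₗ (DFinsupp.mapRange.linearEquiv e).toLinearMap
  have hf : f.ker = ⊥ := LinearMap.ker_eq_bot.2 hU.dfinsupp_lsum_injective
  have hg : g.ker = ⊥ := LinearMap.ker_eq_bot.2 <|
    hU'.dfinsupp_lsum_injective.comp (DFinsupp.mapRange.linearEquiv e).injective
  obtain ⟨φ, hφ⟩ := exists_linearEquiv_comp_eq_of_ker_eq (hf.trans hg.symm)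
  refine ⟨φ, fun i => ?_⟩
  have hφi : φ.toLinearMap ∘ₗ (U i).subtype = (U' i).subtype ∘ₗ (e i).toLinearMap :=
    LinearMap.ext fun x => by
      simpa [f, g] using LinearMap.congr_fun hφ (DFinsupp.single i x)
  calc (U i).map φ.toLinearMap
      = LinearMap.range (φ.toLinearMap ∘ₗ (U i).subtype) := by
        rw [LinearMap.range_comp, Submodule.range_subtype]
    _ = U' i := by
        rw [hφi, LinearMap.range_comp, LinearEquiv.range, Submodule.map_top,
          Submodule.range_subtype]

theorem finrank_sup_of_disjoint {U V : Submodule K E} (h : Disjoint U V) :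
    finrank K ↥(U ⊔ V) = finrank K U + finrank K V := by
  rw [← Submodule.finrank_sup_add_finrank_inf_eq, h.eq_bot, finrank_bot, add_zero]

theorem exists_linearEquiv_map_eq_and_map_eq {U V U' V' : Submodule K E}
    (hU : finrank K U = finrank K U') (hV : finrank K V = finrank K V')
    (hI : finrank K ↥(U ⊓ V) = finrank K ↥(U' ⊓ V')) :
    ∃ φ : E ≃ₗ[K] E, U.map φ.toLinearMap = U' ∧ V.map φ.toLinearMap = V' := by
  obtain ⟨W, hW, hW0, hW1, hW2⟩ := exists_iSupIndep_sup_eq U V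
  obtain ⟨W', hW', hW0', hW1', hW2'⟩ := exists_iSupIndep_sup_eq U' V'
  have hW01 := finrank_sup_of_disjoint (hW.pairwiseDisjoint (by decide : (0 : Fin 3) ≠ 1))
  have hW02 := finrank_sup_of_disjoint (hW.pairwiseDisjoint (by decide : (0 : Fin 3) ≠ 2))
  have hW01' := finrank_sup_of_disjoint (hW'.pairwiseDisjoint (by decide : (0 : Fin 3) ≠ 1))
  have hW02' := finrank_sup_of_disjoint (hW'.pairwiseDisjoint (by decide : (0 : Fin 3) ≠ 2))
  have hfinrank i : finrank K (W i) = finrank K (W' i) := by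
    rw [hW1, hW0] at hW01
    rw [hW2, hW0] at hW02
    rw [hW1', hW0'] at hW01'
    rw [hW2', hW0'] at hW02'
    match i with
    | 0 => rw [hW0, hW0', hI]
    | 1 => lia
    | 2 => lia
  obtain ⟨φ, hφ⟩ := exists_linearEquiv_map_eq_of_iSupIndep hW hW' hfinrank
  refine ⟨φ, ?_, ?_⟩
  · rw [← hW1, ← hW1', Submodule.map_sup, hφ, hφ]
  · rw [← hW2, ← hW2', Submodule.map_sup, hφ, hφ]

theorem exists_linearEquiv_map_eq {U U' : Submodule K E} (h : finrank K U = finrank K U') :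
    ∃ φ : E ≃ₗ[K] E, U.map φ.toLinearMap = U' := by
  obtain ⟨φ, hφ, -⟩ := exists_linearEquiv_map_eq_and_map_eq h h (by rwa [inf_idem, inf_idem])
  exact ⟨φ, hφ⟩

theorem finrank_map_mkQ_add_finrank_inf (U V : Submodule K E) :
    finrank K (U.map V.mkQ) + finrank K ↥(U ⊓ V) = finrank K U := by
  rw [← (V.mkQ.domRestrict U).finrank_range_add_finrank_ker, LinearMap.range_domRestrict,
    LinearMap.ker_domRestrict, Submodule.ker_mkQ, ← Submodule.map_comap_subtype,
    Submodule.finrank_map_subtype_eq]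

end LinearAlgebra

section Matrices

variable {F : Type*} [Field F] {n m : ℕ}

theorem finrank_rowSpace (M : Matrix (Fin n) (Fin m) F) : finrank F (rowSpace M) = M.rank :=
  M.rank_eq_finrank_span_row.symm

theorem rowSpace_mul (A : GL (Fin n) F) (M : Matrix (Fin n) (Fin m) F) :
    rowSpace (A.1 * M) = rowSpace M := by
  have hle (A : Matrix (Fin n) (Fin n) F) (M : Matrix (Fin n) (Fin m) F) :
      rowSpace (A * M) ≤ rowSpace M := by
    refine Submodule.span_le.2 ?_
    rintro _ ⟨i, rfl⟩
    rw [Matrix.row, Matrix.mul_apply_eq_vecMul, Matrix.vecMul_eq_sum]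
    exact Submodule.sum_mem _ fun j _ => Submodule.smul_mem _ _ (Submodule.subset_span ⟨j, rfl⟩)
  refine (hle A.1 M).antisymm ?_
  simpa [← Matrix.mul_assoc] using hle (A⁻¹).1 (A.1 * M)

theorem mem_ker_toLin'_iff (M : Matrix (Fin n) (Fin m) F) (v : Fin m → F) :
    v ∈ (Matrix.toLin' M).ker ↔ ∀ w ∈ rowSpace M, w ⬝ᵥ v = 0 := by
  rw [LinearMap.mem_ker, Matrix.toLin'_apply]
  refine ⟨fun hv w hw => ?_, fun h => funext fun i => h _ (Submodule.subset_span ⟨i, rfl⟩)⟩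
  induction hw using Submodule.span_induction with
  | mem _ h => obtain ⟨i, rfl⟩ := h; exact congrFun hv i
  | zero => exact zero_dotProduct v
  | add x y _ _ hx hy => rw [add_dotProduct, hx, hy, add_zero]
  | smul c x _ hx => rw [smul_dotProduct, hx, smul_zero]

theorem exists_mul_eq_of_rowSpace_eq {M N : Matrix (Fin n) (Fin m) F}
    (h : rowSpace M = rowSpace N) : ∃ A : GL (Fin n) F, A.1 * M = N := by
  have hker : (Matrix.toLin' M).ker = (Matrix.toLin' N).ker := by
    ext v
    rw [mem_ker_toLin'_iff, mem_ker_toLin'_iff, h]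
  obtain ⟨φ, hφ⟩ := exists_linearEquiv_comp_eq_of_ker_eq hker
  let A : GL (Fin n) F :=
    Matrix.GeneralLinearGroup.toLin.symm (LinearMap.GeneralLinearGroup.ofLinearEquiv φ)
  have hA : Matrix.toLin' A.1 = φ.toLinearMap := Matrix.toLin'_toMatrix' φ.toLinearMap
  exact ⟨A, Matrix.toLin'.injective (by rw [Matrix.toLin'_mul, hA, hφ])⟩

/-- The action of `GL(n, F) × GL(F^m)` on `n × m` matrices: multiply by `A` on the left and apply
`φ` to each row. Both the channel and all the counting functions are invariant under it. -/
def transform (A : GL (Fin n) F) (φ : (Fin m → F) ≃ₗ[F] (Fin m → F)) :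
    Matrix (Fin n) (Fin m) F ≃+ Matrix (Fin n) (Fin m) F :=
  AddEquiv.trans
    { toFun := fun M => A.1 * M
      invFun := fun M => (A⁻¹).1 * M
      left_inv := fun M => by
        dsimp only
        rw [← Matrix.mul_assoc, ← Units.val_mul, inv_mul_cancel, Units.val_one, Matrix.one_mul]
      right_inv := fun M => by
        dsimp only
        rw [← Matrix.mul_assoc, ← Units.val_mul, mul_inv_cancel, Units.val_one, Matrix.one_mul]
      map_add' := Matrix.mul_add A.1 }
    (Matrix.ofAddEquiv.symm.trans <|
      (AddEquiv.piCongrRight fun _ => φ.toAddEquiv).trans Matrix.ofAddEquiv)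

variable (A : GL (Fin n) F) (φ : (Fin m → F) ≃ₗ[F] (Fin m → F)) (M : Matrix (Fin n) (Fin m) F)

theorem row_transform : (transform A φ M).row = φ ∘ (A.1 * M).row := rfl

theorem mul_transform (B : GL (Fin n) F) : B.1 * transform A φ M = transform (B * A) φ M := by
  refine funext fun i => ?_
  change (B.1 * transform A φ M) i = φ (((B * A).1 * M) i)
  rw [Units.val_mul, Matrix.mul_assoc, Matrix.mul_apply_eq_vecMul, Matrix.mul_apply_eq_vecMul,
    Matrix.vecMul_eq_sum, Matrix.vecMul_eq_sum, map_sum]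
  exact Finset.sum_congr rfl fun j _ => (map_smul φ _ _).symm

theorem rowSpace_transform : rowSpace (transform A φ M) = (rowSpace M).map φ.toLinearMap := by
  rw [rowSpace, row_transform, Set.range_comp, ← LinearEquiv.coe_toLinearMap,
    ← Submodule.map_span]
  exact congrArg _ (rowSpace_mul A M)

theorem rank_transform : (transform A φ M).rank = M.rank := by
  rw [← finrank_rowSpace, rowSpace_transform, LinearEquiv.finrank_map_eq, finrank_rowSpace]

variable {φ M}

theorem exists_transform_eq {N : Matrix (Fin n) (Fin m) F}
    (h : (rowSpace M).map φ.toLinearMap = rowSpace N) : ∃ A, transform A φ M = N := by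
  obtain ⟨A, hA⟩ := exists_mul_eq_of_rowSpace_eq ((rowSpace_transform 1 φ M).trans h)
  exact ⟨A, by rw [← hA, mul_transform, mul_one]⟩

theorem exists_transform_eq_of_rank_eq {N : Matrix (Fin n) (Fin m) F} (h : M.rank = N.rank) :
    ∃ A φ, transform A φ M = N := by
  rw [← finrank_rowSpace, ← finrank_rowSpace] at h
  obtain ⟨φ, hφ⟩ := exists_linearEquiv_map_eq h
  obtain ⟨A, hA⟩ := exists_transform_eq hφ
  exact ⟨A, φ, hA⟩

theorem exists_rowSpace_eq {V : Submodule F (Fin m → F)} (hV : finrank F V ≤ n) :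
    ∃ M : Matrix (Fin n) (Fin m) F, rowSpace M = V := by
  obtain ⟨f, -, hf, -⟩ := Submodule.exists_fun_fin_finrank_span_eq F (V : Set (Fin m → F))
  rw [← V.span_eq] at hV
  refine ⟨.of (Function.extend (Fin.castLE hV) f 0), ?_⟩
  calc Submodule.span F (Set.range (Function.extend (Fin.castLE hV) f 0))
      = V ⊔ Submodule.span F (0 '' (Set.range (Fin.castLE hV))ᶜ) := by
        rw [Set.range_extend (Fin.castLE_injective hV), Submodule.span_union,
          hf.trans V.span_eq]
    _ = V := sup_eq_left.2 <| Submodule.span_le.2 <| by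
        rintro _ ⟨i, -, rfl⟩
        exact V.zero_mem

theorem exists_rank_eq {r : ℕ} (hr : r ≤ min n m) :
    ∃ M : Matrix (Fin n) (Fin m) F, M.rank = r := by
  obtain ⟨V, hV⟩ : ∃ V : Submodule F (Fin m → F), finrank F V = r := by
    obtain ⟨f, hf⟩ := exists_linearIndependent_of_le_finrank (R := F)
      (M := Fin m → F) (n := r) (by rw [finrank_fin_fun]; lia)
    exact ⟨_, (finrank_span_eq_card hf).trans (Fintype.card_fin r)⟩
  obtain ⟨M, hM⟩ := exists_rowSpace_eq (n := n) (V := V) (by lia)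
  exact ⟨M, by rw [← finrank_rowSpace, hM, hV]⟩

end Matrices

section CountingFunctions

variable {F : Type*} [Field F] {n m : ℕ}

theorem quotDim_add_finrank_inf (U V : Submodule F (Fin m → F)) :
    quotDim U V + finrank F ↥(U ⊓ V) = finrank F U :=
  finrank_map_mkQ_add_finrank_inf U V

variable (A : GL (Fin n) F) (φ : (Fin m → F) ≃ₗ[F] (Fin m → F))

theorem count0_map (U : Submodule F (Fin m → F)) :
    count0 F n m (U.map φ.toLinearMap) = count0 F n m U := by
  refine (Nat.card_congr ((transform 1 φ).toEquiv.subtypeEquiv fun M => ?_)).symm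
  simp [rowSpace_transform, map_eq_map_iff]

theorem count1_transform (M : Matrix (Fin n) (Fin m) F) (V : Submodule F (Fin m → F)) (r : ℕ) :
    count1 F n m (transform A φ M) (V.map φ.toLinearMap) r = count1 F n m M V r := by
  refine (Nat.card_congr ((transform A φ).toEquiv.subtypeEquiv fun B => ?_)).symm
  simp [← map_add, rank_transform, rowSpace_transform, map_eq_map_iff]

theorem count2_transform (X : Matrix (Fin n) (Fin m) F) (r rB : ℕ) :
    count2 F n m (transform A φ X) r rB = count2 F n m X r rB := by
  refine (Nat.card_congr ((transform A φ).toEquiv.subtypeEquiv fun B => ?_)).symm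
  simp [← map_add, rank_transform]

variable [Fintype F]

theorem count0_eq_f0 {u : ℕ} {U : Submodule F (Fin m → F)} (hU : finrank F U = u) :
    count0 F n m U = f0 F n m u := by
  have h : ∃ U : Submodule F (Fin m → F), finrank F U = u := ⟨U, hU⟩
  obtain ⟨φ, hφ⟩ := exists_linearEquiv_map_eq (hU.trans h.choose_spec.symm)
  rw [f0, dif_pos h, ← hφ, count0_map]

theorem count1_eq_f1 {u v h r : ℕ} {M : Matrix (Fin n) (Fin m) F}
    {V : Submodule F (Fin m → F)} (hM : finrank F (rowSpace M) = u) (hV : finrank F V = v)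
    (hMV : quotDim (rowSpace M) V = h) : count1 F n m M V r = f1 F n m u v h r := by
  have hex : ∃ p : Matrix (Fin n) (Fin m) F × Submodule F (Fin m → F),
      finrank F (rowSpace p.1) = u ∧ finrank F p.2 = v ∧ quotDim (rowSpace p.1) p.2 = h :=
    ⟨(M, V), hM, hV, hMV⟩
  obtain ⟨hM', hV', hMV'⟩ := hex.choose_spec
  have hinf := quotDim_add_finrank_inf (rowSpace M) V
  have hinf' := quotDim_add_finrank_inf (rowSpace hex.choose.1) hex.choose.2
  obtain ⟨φ, hφM, hφV⟩ := exists_linearEquiv_map_eq_and_map_eq (hM.trans hM'.symm)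
    (hV.trans hV'.symm) (by lia)
  obtain ⟨A, hA⟩ := exists_transform_eq hφM
  rw [f1, dif_pos hex, ← hA, ← hφV, count1_transform]

theorem count2_eq_f2 {r rX rB : ℕ} {X : Matrix (Fin n) (Fin m) F} (hX : X.rank = rX) :
    count2 F n m X r rB = f2 F n m r rX rB := by
  have h : ∃ X : Matrix (Fin n) (Fin m) F, X.rank = rX := ⟨X, hX⟩
  obtain ⟨A, φ, hA⟩ := exists_transform_eq_of_rank_eq (hX.trans h.choose_spec.symm)
  rw [f2, dif_pos h, ← hA, count2_transform]

end CountingFunctions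

section SubspaceCounting

/-- `(q ^ a - 1) (q ^ a - q) ⋯ (q ^ a - q ^ (d - 1))`, the number of linearly independent families
of `d` vectors in a space of dimension `a` over a field with `q` elements. It is `0` for `a < d`. -/
def numIndep (q : ℝ) (a d : ℕ) : ℝ := ∏ i ∈ Finset.range d, (q ^ a - q ^ i)

theorem numIndep_eq_zero (q : ℝ) {a d : ℕ} (h : a < d) : numIndep q a d = 0 :=
  Finset.prod_eq_zero (Finset.mem_range.2 h) (sub_self _)

theorem numIndep_self_ne_zero {q : ℝ} (hq : 1 < q) (d : ℕ) : numIndep q d d ≠ 0 :=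
  Finset.prod_ne_zero_iff.2 fun _ hi =>
    (sub_pos.2 (pow_lt_pow_right₀ hq (Finset.mem_range.1 hi))).ne'

theorem gaussBinom_natCast (q : ℝ) (a d : ℕ) :
    gaussBinom q a d = numIndep q a d / numIndep q d d := by
  by_cases h : d ≤ a
  · rw [gaussBinom, if_pos ⟨by positivity, by exact_mod_cast h⟩, Int.toNat_natCast,
      Finset.prod_div_distrib, numIndep, numIndep]
  · rw [gaussBinom, if_neg (by lia), numIndep_eq_zero q (not_le.1 h), zero_div]

variable {K E : Type*} [Field K] [AddCommGroup E] [Module K E]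

theorem natCard_linearIndependent [Fintype K] [Finite E] (k : ℕ) :
    (Nat.card {s : Fin k → E // LinearIndependent K s} : ℝ) =
      numIndep (Fintype.card K) (finrank K E) k := by
  by_cases hk : k ≤ finrank K E
  · rw [card_linearIndependent hk, numIndep, Finset.prod_range, Nat.cast_prod]
    refine Finset.prod_congr rfl fun i _ => ?_
    rw [Nat.cast_sub (Nat.pow_le_pow_right Fintype.card_pos (by lia)), Nat.cast_pow, Nat.cast_pow]
  · rw [numIndep_eq_zero _ (not_le.1 hk), Nat.cast_eq_zero, Nat.card_eq_zero]
    exact Or.inl ⟨fun s => hk (by simpa using s.2.fintype_card_le_finrank)⟩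

theorem natCard_linearIndependent_mkQ [Fintype K] [Finite E] (U : Submodule K E) (k : ℕ) :
    (Nat.card {c : Fin k → E // LinearIndependent K (U.mkQ ∘ c)} : ℝ) =
      numIndep (Fintype.card K) (finrank K (E ⧸ U)) k *
        ((Fintype.card K : ℝ) ^ finrank K U) ^ k := by
  let e : (Fin k → E) ≃ (Fin k → E ⧸ U) × (Fin k → U) :=
    (Equiv.arrowCongr (Equiv.refl _) AddSubgroup.addGroupEquivQuotientProdAddSubgroup).trans
      (Equiv.arrowProdEquivProdArrow _ _ _)
  have h : {c : Fin k → E // LinearIndependent K (U.mkQ ∘ c)} ≃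
      {s : Fin k → E ⧸ U // LinearIndependent K s} × (Fin k → U) :=
    (e.subtypeEquiv fun _ => Iff.rfl).trans
      (Equiv.prodSubtypeFstEquivSubtypeProd (p := fun s => LinearIndependent K s))
  have : Finite (E ⧸ U) := Finite.of_surjective _ U.mkQ_surjective
  rw [Nat.card_congr h, Nat.card_prod, Nat.card_fun, Nat.card_fin,
    Module.natCard_eq_pow_finrank (K := K) (V := U), Nat.card_eq_fintype_card (α := K)]
  push_cast
  rw [natCard_linearIndependent]

/-- A pair of families of vectors, the first linearly independent in `U`, the second linearly
independent modulo `U`. The span `V` of both is then of dimension `d + k`, and `U ⊓ V` is of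
dimension `d`; such subspaces are counted through their adapted families. -/
def IsAdapted (U : Submodule K E) {d k : ℕ} (p : (Fin d → E) × (Fin k → E)) : Prop :=
  (∀ i, p.1 i ∈ U) ∧ LinearIndependent K p.1 ∧ LinearIndependent K (U.mkQ ∘ p.2)

theorem natCard_isAdapted [Fintype K] [Finite E] (U : Submodule K E) (d k : ℕ) :
    (Nat.card {p : (Fin d → E) × (Fin k → E) // IsAdapted U p} : ℝ) =
      numIndep (Fintype.card K) (finrank K U) d *
        (numIndep (Fintype.card K) (finrank K (E ⧸ U)) k *
          ((Fintype.card K : ℝ) ^ finrank K U) ^ k) := by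
  let e : {p : (Fin d → E) × (Fin k → E) // IsAdapted U p} ≃
      {a : Fin d → U // LinearIndependent K a} ×
        {c : Fin k → E // LinearIndependent K (U.mkQ ∘ c)} :=
    { toFun := fun p =>
        (⟨fun i => ⟨p.1.1 i, p.2.1 i⟩, LinearIndependent.of_comp U.subtype p.2.2.1⟩,
          ⟨p.1.2, p.2.2.2⟩)
      invFun := fun p => ⟨(fun i => p.1.1 i, p.2.1), fun i => (p.1.1 i).2,
        p.1.2.map' U.subtype U.ker_subtype, p.2.2⟩ }
  rw [Nat.card_congr e, Nat.card_prod, Nat.cast_mul, natCard_linearIndependent,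
    natCard_linearIndependent_mkQ]

theorem isAdapted_comap_subtype_iff (U V : Submodule K E) {d k : ℕ}
    (p : (Fin d → V) × (Fin k → V)) :
    IsAdapted (U.comap V.subtype) p ↔ IsAdapted U (V.subtype ∘ p.1, V.subtype ∘ p.2) := by
  let f : (V ⧸ U.comap V.subtype) →ₗ[K] E ⧸ U := (U.comap V.subtype).mapQ U V.subtype le_rfl
  have hf : f.ker = ⊥ := by rw [Submodule.ker_mapQ, Submodule.mkQ_map_self]
  exact and_congr Iff.rfl <| and_congr (V.subtype.linearIndependent_iff V.ker_subtype).symm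
    (f.linearIndependent_iff hf (v := (U.comap V.subtype).mkQ ∘ p.2)).symm

theorem natCard_isAdapted_mem [Fintype K] [Finite E] {U V : Submodule K E} {d k : ℕ}
    (hV : finrank K V = d + k) (hUV : finrank K ↥(U ⊓ V) = d) :
    (Nat.card {p : (Fin d → E) × (Fin k → E) //
        IsAdapted U p ∧ (∀ i, p.1 i ∈ V) ∧ (∀ i, p.2 i ∈ V)} : ℝ) =
      numIndep (Fintype.card K) d d *
        (numIndep (Fintype.card K) k k * ((Fintype.card K : ℝ) ^ d) ^ k) := by
  have hd : finrank K (U.comap V.subtype) = d := by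
    rw [← Submodule.finrank_map_subtype_eq, Submodule.map_comap_subtype, inf_comm, hUV]
  have hk : finrank K (V ⧸ U.comap V.subtype) = k := by
    have := (U.comap V.subtype).finrank_quotient_add_finrank
    lia
  have h := natCard_isAdapted (U.comap V.subtype) d k
  rw [hd, hk] at h
  rw [← h]
  exact congrArg _ <| Nat.card_congr
    { toFun := fun p => ⟨(fun i => ⟨p.1.1 i, p.2.2.1 i⟩, fun i => ⟨p.1.2 i, p.2.2.2 i⟩),
        (isAdapted_comap_subtype_iff U V _).2 p.2.1⟩
      invFun := fun p => ⟨(V.subtype ∘ p.1.1, V.subtype ∘ p.1.2),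
        (isAdapted_comap_subtype_iff U V _).1 p.2, fun i => (p.1.1 i).2, fun i => (p.1.2 i).2⟩ }

theorem le_finrank_of_forall_mem [FiniteDimensional K E] {l : ℕ} {v : Fin l → E}
    (hv : LinearIndependent K v) {W : Submodule K E} (hW : ∀ i, v i ∈ W) : l ≤ finrank K W := by
  have hspan := finrank_span_eq_card hv
  rw [Fintype.card_fin] at hspan
  rw [← hspan]
  exact Submodule.finrank_mono (Submodule.span_le.2 (Set.range_subset_iff.2 hW))

theorem IsAdapted.existsUnique_submodule [FiniteDimensional K E] {U : Submodule K E} {d k : ℕ}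
    {p : (Fin d → E) × (Fin k → E)} (hp : IsAdapted U p) :
    ∃! V : Submodule K E, (finrank K V = d + k ∧ finrank K ↥(U ⊓ V) = d) ∧
      (∀ i, p.1 i ∈ V) ∧ (∀ i, p.2 i ∈ V) := by
  obtain ⟨hU, ha, hc⟩ := hp
  let V : Submodule K E := Submodule.span K (Set.range (Sum.elim p.1 p.2))
  have hVa (i) : p.1 i ∈ V := Submodule.subset_span ⟨Sum.inl i, rfl⟩
  have hVc (i) : p.2 i ∈ V := Submodule.subset_span ⟨Sum.inr i, rfl⟩
  have hV_le : finrank K V ≤ d + k := by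
    simpa [Set.finrank] using finrank_range_le_card (R := K) (Sum.elim p.1 p.2)
  have hd : d ≤ finrank K ↥(U ⊓ V) := le_finrank_of_forall_mem ha fun i => ⟨hU i, hVa i⟩
  have hk : k ≤ finrank K (V.map U.mkQ) :=
    le_finrank_of_forall_mem hc fun i => Submodule.mem_map_of_mem (hVc i)
  have hadd := finrank_map_mkQ_add_finrank_inf V U
  rw [inf_comm] at hadd
  refine ⟨V, ⟨⟨by lia, by lia⟩, hVa, hVc⟩, ?_⟩
  rintro W ⟨⟨hW, -⟩, hWa, hWc⟩
  refine (Submodule.eq_of_le_of_finrank_eq (Submodule.span_le.2 ?_) ?_).symm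
  · rintro _ ⟨i | i, rfl⟩
    exacts [hWa i, hWc i]
  · change finrank K V = finrank K W
    lia

theorem natCard_submodule_mul [Fintype K] [Finite E] (U : Submodule K E) (d k : ℕ) :
    (Nat.card {V : Submodule K E // finrank K V = d + k ∧ finrank K ↥(U ⊓ V) = d} : ℝ) *
        (numIndep (Fintype.card K) d d *
          (numIndep (Fintype.card K) k k * ((Fintype.card K : ℝ) ^ d) ^ k)) =
      numIndep (Fintype.card K) (finrank K U) d *
        (numIndep (Fintype.card K) (finrank K (E ⧸ U)) k *
          ((Fintype.card K : ℝ) ^ finrank K U) ^ k) := by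
  let e : (Σ V : {V : Submodule K E // finrank K V = d + k ∧ finrank K ↥(U ⊓ V) = d},
        {p : (Fin d → E) × (Fin k → E) //
          IsAdapted U p ∧ (∀ i, p.1 i ∈ V.1) ∧ (∀ i, p.2 i ∈ V.1)}) ≃
      {p : (Fin d → E) × (Fin k → E) // IsAdapted U p} := by
    refine Equiv.ofBijective (fun x => ⟨x.2.1, x.2.2.1⟩) ⟨?_, ?_⟩
    · rintro ⟨⟨V, hV⟩, p, hp⟩ ⟨⟨V', hV'⟩, p', hp'⟩ h
      obtain rfl : p = p' := congrArg Subtype.val h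
      obtain rfl : V = V' := hp.1.existsUnique_submodule.unique ⟨hV, hp.2⟩ ⟨hV', hp'.2⟩
      rfl
    · rintro ⟨p, hp⟩
      obtain ⟨V, ⟨hV, hpV⟩, -⟩ := hp.existsUnique_submodule
      exact ⟨⟨⟨V, hV⟩, p, hp, hpV⟩, rfl⟩
  have : Fintype {V : Submodule K E // finrank K V = d + k ∧ finrank K ↥(U ⊓ V) = d} :=
    Fintype.ofFinite _
  rw [← natCard_isAdapted U d k, ← Nat.card_congr e, Nat.card_sigma, Nat.cast_sum,
    Finset.sum_congr rfl fun V _ => natCard_isAdapted_mem V.2.1 V.2.2, Finset.sum_const,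
    Finset.card_univ, Nat.card_eq_fintype_card, nsmul_eq_mul]

theorem natCard_submodule_eq_gaussBinom [Fintype K] [Finite E] (U : Submodule K E) (d k : ℕ) :
    (Nat.card {V : Submodule K E // finrank K V = d + k ∧ finrank K ↥(U ⊓ V) = d} : ℝ) =
      (Fintype.card K : ℝ) ^ ((k : ℤ) * ((finrank K U : ℤ) - d)) *
        gaussBinom (Fintype.card K) (finrank K (E ⧸ U)) k *
        gaussBinom (Fintype.card K) (finrank K U) d := by
  have hq : (1 : ℝ) < Fintype.card K := by exact_mod_cast Fintype.one_lt_card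
  have hq₀ : (Fintype.card K : ℝ) ≠ 0 := by positivity
  have hd := numIndep_self_ne_zero hq d
  have hk := numIndep_self_ne_zero hq k
  have hpow : ((Fintype.card K : ℝ) ^ finrank K U) ^ k =
      (Fintype.card K : ℝ) ^ ((k : ℤ) * ((finrank K U : ℤ) - d)) *
        ((Fintype.card K : ℝ) ^ d) ^ k := by
    rw [← pow_mul, ← pow_mul, ← zpow_natCast, ← zpow_natCast, ← zpow_add₀ hq₀]
    congr 1
    push_cast
    ring
  rw [← mul_left_inj' (mul_ne_zero hd (mul_ne_zero hk (pow_ne_zero k (pow_ne_zero d hq₀)))),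
    natCard_submodule_mul, hpow, gaussBinom_natCast, gaussBinom_natCast]
  field_simp

theorem natCard_submodule_quotDim {F : Type*} [Field F] [Fintype F] {m : ℕ}
    {U : Submodule F (Fin m → F)} {r : ℕ} (hU : finrank F U = r) (u : ℕ) {h : ℕ} (hh : h ≤ r) :
    (Nat.card {V : Submodule F (Fin m → F) // finrank F V = u ∧ quotDim U V = h} : ℝ) =
      (Fintype.card F : ℝ) ^ (((u : ℤ) - r + h) * h) *
        gaussBinom (Fintype.card F) (m - r) ((u : ℤ) - r + h) *
        gaussBinom (Fintype.card F) r ((r : ℤ) - h) := by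
  have hquot (V : Submodule F (Fin m → F)) : quotDim U V = h ↔ finrank F ↥(U ⊓ V) = r - h := by
    have := quotDim_add_finrank_inf U V
    lia
  rw [Nat.card_congr (Equiv.subtypeEquivRight fun V => and_congr_right' (hquot V))]
  by_cases hk : r - h ≤ u
  · obtain ⟨k, rfl⟩ := Nat.exists_eq_add_of_le hk
    have hQ : finrank F ((Fin m → F) ⧸ U) = m - r := by
      rw [Submodule.finrank_quotient, finrank_fin_fun, hU]
    have hk' : ((r - h + k : ℕ) : ℤ) - r + h = k := by lia
    rw [natCard_submodule_eq_gaussBinom, hQ, hU, hk', Nat.cast_sub hh, sub_sub_cancel]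
  · rw [gaussBinom, if_neg (by lia), mul_zero, zero_mul, Nat.cast_eq_zero, Nat.card_eq_zero]
    refine Or.inl ⟨fun ⟨V, hV, hUV⟩ => hk ?_⟩
    rw [← hV, ← hUV]
    exact Submodule.finrank_mono inf_le_right

end SubspaceCounting

section Entropy

variable {α β ι : Type*}

theorem neg_sum_mul_logb_le (s : Finset α) {b : ℝ} (hb : 1 < b) {p : α → ℝ}
    (hp : ∀ x ∈ s, 0 ≤ p x) :
    -∑ x ∈ s, p x * Real.logb b (p x) ≤
      (∑ x ∈ s, p x) * Real.logb b (s.card / ∑ x ∈ s, p x) := by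
  rcases s.eq_empty_or_nonempty with rfl | hs
  · simp
  have hc : (0 : ℝ) < s.card := Nat.cast_pos.2 hs.card_pos
  have jensen := Real.concaveOn_negMulLog.le_map_sum (t := s) (w := fun _ => (s.card : ℝ)⁻¹)
    (fun _ _ => by positivity) (by rw [Finset.sum_const, nsmul_eq_mul, mul_inv_cancel₀ hc.ne']) hp
  rw [← inv_div, Real.logb_inv, mul_neg, neg_le_neg_iff]
  simp only [smul_eq_mul, ← Finset.mul_sum, Real.negMulLog, neg_mul, Finset.sum_neg_distrib,
    mul_neg, neg_le_neg_iff, mul_assoc] at jensen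
  have h := le_of_mul_le_mul_left jensen (by positivity)
  rw [inv_mul_eq_div] at h
  simp only [Real.logb, mul_div_assoc', ← Finset.sum_div]
  exact div_le_div_of_nonneg_right h (Real.log_pos hb).le

theorem neg_sum_mul_logb_eq (s : Finset α) (b : ℝ) {p : α → ℝ}
    (hp : ∀ x ∈ s, ∀ y ∈ s, p x = p y) :
    -∑ x ∈ s, p x * Real.logb b (p x) =
      (∑ x ∈ s, p x) * Real.logb b (s.card / ∑ x ∈ s, p x) := by
  rcases s.eq_empty_or_nonempty with rfl | ⟨y, hy⟩
  · simp
  have hc : (s.card : ℝ) ≠ 0 := Nat.cast_ne_zero.2 (Finset.card_ne_zero_of_mem hy)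
  rw [Finset.sum_congr rfl fun x hx => by rw [hp x hx y hy],
    Finset.sum_congr (s₁ := s) (f := p) rfl fun x hx => hp x hx y hy, Finset.sum_const,
    Finset.sum_const, nsmul_eq_mul, nsmul_eq_mul, div_mul_cancel_left₀ hc, Real.logb_inv]
  ring

variable [Fintype α]

/-- The Shannon entropy, with logarithms to base `b`, of the distribution `p` on a finite set. -/
def entropy (b : ℝ) (p : α → ℝ) : ℝ := -∑ x, p x * Real.logb b (p x)

open Classical in
/-- The distribution of `κ x` when `x` has distribution `p`. -/
def pushforward (κ : α → ι) (p : α → ℝ) (i : ι) : ℝ := ∑ x with κ x = i, p x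

theorem pushforward_nonneg (κ : α → ι) {p : α → ℝ} (hp : ∀ x, 0 ≤ p x) (i : ι) :
    0 ≤ pushforward κ p i :=
  Finset.sum_nonneg fun x _ => hp x

theorem sum_pushforward_mul [Fintype ι] (κ : α → ι) (p : α → ℝ) (g : ι → ℝ) :
    ∑ i, pushforward κ p i * g i = ∑ x, p x * g (κ x) := by
  classical
  rw [← Finset.sum_fiberwise Finset.univ κ]
  refine Finset.sum_congr rfl fun i _ => ?_
  rw [pushforward, Finset.sum_mul]
  exact Finset.sum_congr rfl fun x hx => by rw [(Finset.mem_filter.1 hx).2]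

open Classical in
theorem natCard_fiber (κ : α → ι) (i : ι) :
    Nat.card {x // κ x = i} = (Finset.univ.filter fun x => κ x = i).card := by
  rw [Nat.card_eq_fintype_card, Fintype.card_subtype]

theorem pushforward_eq_natCard_mul {κ : α → ι} {p : α → ℝ} {i : ι} {c : ℝ}
    (hp : ∀ x, κ x = i → p x = c) :
    pushforward κ p i = Nat.card {x // κ x = i} * c := by
  classical
  rw [pushforward, Finset.sum_congr rfl fun x hx => hp x (Finset.mem_filter.1 hx).2,
    Finset.sum_const, nsmul_eq_mul, natCard_fiber]

theorem pushforward_mem_stdSimplex [Fintype ι] (κ : α → ι) {p : α → ℝ}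
    (hp : p ∈ stdSimplex ℝ α) : pushforward κ p ∈ stdSimplex ℝ ι :=
  ⟨pushforward_nonneg κ hp.1, by simpa [hp.2] using sum_pushforward_mul κ p 1⟩

theorem sum_comp_eq_sum_natCard_mul (κ : α → ι) (s : Finset ι) (g : ι → ℝ)
    (hg : ∀ x, κ x ∉ s → g (κ x) = 0) :
    ∑ x, g (κ x) = ∑ i ∈ s, (Nat.card {x // κ x = i} : ℝ) * g i := by
  classical
  have hs : ∑ x, g (κ x) = ∑ x with κ x ∈ s, g (κ x) :=
    (Finset.sum_filter_of_ne fun x _ hx => by_contra fun h => hx (hg x h)).symm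
  rw [hs, ← Finset.sum_fiberwise_of_maps_to (t := s) fun x hx => (Finset.mem_filter.1 hx).2]
  refine Finset.sum_congr rfl fun i hi => ?_
  rw [Finset.filter_filter, Finset.filter_congr fun x _ => and_iff_right_of_imp fun h => h ▸ hi,
    Finset.sum_congr rfl fun x hx => by rw [(Finset.mem_filter.1 hx).2], Finset.sum_const,
    nsmul_eq_mul, Nat.card_eq_fintype_card, Fintype.card_subtype]

open Classical in
theorem entropy_eq_sum_fiberwise [Fintype ι] (κ : α → ι) (b : ℝ) (p : α → ℝ) :
    entropy b p = ∑ i, -∑ x with κ x = i, p x * Real.logb b (p x) := by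
  rw [entropy, ← Finset.sum_fiberwise Finset.univ κ, Finset.sum_neg_distrib]

theorem entropy_le_sum_pushforward [Fintype ι] (κ : α → ι) {b : ℝ} (hb : 1 < b) {p : α → ℝ}
    (hp : ∀ x, 0 ≤ p x) :
    entropy b p ≤ ∑ i, pushforward κ p i *
      Real.logb b ((Nat.card {x // κ x = i} : ℝ) / pushforward κ p i) := by
  rw [entropy_eq_sum_fiberwise κ]
  refine Finset.sum_le_sum fun i _ => ?_
  rw [natCard_fiber]
  exact neg_sum_mul_logb_le _ hb fun x _ => hp x

theorem entropy_eq_sum_pushforward [Fintype ι] {κ : α → ι} (b : ℝ) {p : α → ℝ}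
    (hp : ∀ x y, κ x = κ y → p x = p y) :
    entropy b p = ∑ i, pushforward κ p i *
      Real.logb b ((Nat.card {x // κ x = i} : ℝ) / pushforward κ p i) := by
  classical
  rw [entropy_eq_sum_fiberwise κ]
  refine Finset.sum_congr rfl fun i _ => ?_
  rw [natCard_fiber]
  exact neg_sum_mul_logb_eq _ b fun x hx y hy =>
    hp x y ((Finset.mem_filter.1 hx).2.trans (Finset.mem_filter.1 hy).2.symm)

theorem sum_mul_logb_div_eq_entropy_sub [Fintype β] (b : ℝ) {P : α → ℝ} {W : α → β → ℝ}
    (hP : ∀ x, 0 ≤ P x) (hW : ∀ x y, 0 ≤ W x y) :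
    ∑ x, ∑ y, P x * W x y * Real.logb b (P x * W x y / (P x * ∑ x', P x' * W x' y)) =
      entropy b (fun y => ∑ x, P x * W x y) - ∑ x, P x * entropy b (W x) := by
  have hterm (x : α) (y : β) :
      P x * W x y * Real.logb b (P x * W x y / (P x * ∑ x', P x' * W x' y)) =
        P x * (W x y * Real.logb b (W x y)) -
          P x * W x y * Real.logb b (∑ x', P x' * W x' y) := by
    by_cases hxy : P x * W x y = 0
    · rw [← mul_assoc, hxy, zero_mul, zero_mul, zero_mul, sub_zero]
    obtain ⟨hPx, hWxy⟩ := mul_ne_zero_iff.1 hxy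
    have hsum : ∑ x', P x' * W x' y ≠ 0 := fun h =>
      hxy ((Finset.sum_eq_zero_iff_of_nonneg fun x' _ => mul_nonneg (hP x') (hW x' y)).1 h x
        (Finset.mem_univ x))
    rw [mul_div_mul_left _ _ hPx, Real.logb_div hWxy hsum]
    ring
  simp only [hterm, Finset.sum_sub_distrib, ← Finset.mul_sum]
  rw [Finset.sum_comm (f := fun x y => P x * W x y * _)]
  simp only [← Finset.sum_mul, entropy, mul_neg, Finset.sum_neg_distrib]
  ring

end Entropy

section Channel

variable {F : Type*} [Field F] {n m : ℕ}

/-- The rank of a matrix, as an index of rank distributions. -/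
def rankIndex (M : Matrix (Fin n) (Fin m) F) : Fin (min n m + 1) := ⟨M.rank, rank_lt M⟩

theorem rankIndex_eq_iff {M : Matrix (Fin n) (Fin m) F} {r : Fin (min n m + 1)} :
    rankIndex M = r ↔ M.rank = r := Fin.ext_iff

theorem natCard_rankIndex_eq (r : Fin (min n m + 1)) :
    Nat.card {M : Matrix (Fin n) (Fin m) F // rankIndex M = r} = numRank F n m r :=
  Nat.card_congr (Equiv.subtypeEquivRight fun _ => rankIndex_eq_iff)

variable {R : Fin (min n m + 1) → ℝ}

theorem ugr_nonneg (hR : ∀ r, 0 ≤ R r) (M : Matrix (Fin n) (Fin m) F) : 0 ≤ ugr R M :=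
  div_nonneg (hR _) (Nat.cast_nonneg _)

theorem ugr_eq_of_rankIndex_eq {M : Matrix (Fin n) (Fin m) F} {r : Fin (min n m + 1)}
    (h : rankIndex M = r) : ugr R M = R r / numRank F n m r := by
  subst h
  rfl

theorem ugr_transform (A : GL (Fin n) F) (φ : (Fin m → F) ≃ₗ[F] (Fin m → F))
    (M : Matrix (Fin n) (Fin m) F) : ugr R (transform A φ M) = ugr R M :=
  ugr_eq_of_rankIndex_eq (Fin.ext (rank_transform A φ M))

theorem numRank_pos [Finite F] (r : Fin (min n m + 1)) : 0 < numRank F n m r := by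
  obtain ⟨M, hM⟩ := exists_rank_eq (F := F) (Nat.lt_succ_iff.1 r.2)
  have : Nonempty {M : Matrix (Fin n) (Fin m) F // M.rank = r} := ⟨⟨M, hM⟩⟩
  exact Nat.card_pos

variable [Fintype F]

theorem pushforward_ugr {ι : Type*} (κ : Matrix (Fin n) (Fin m) F → ι) (i : ι) :
    pushforward κ (ugr R) i = ∑ r, R r *
      ((Nat.card {B : Matrix (Fin n) (Fin m) F // B.rank = r ∧ κ B = i} : ℝ) /
        numRank F n m r) := by
  classical
  rw [pushforward, ← Finset.sum_fiberwise _ rankIndex]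
  refine Finset.sum_congr rfl fun r _ => ?_
  rw [Finset.sum_congr rfl fun B hB => ugr_eq_of_rankIndex_eq (Finset.mem_filter.1 hB).2,
    Finset.sum_const, Finset.filter_filter, nsmul_eq_mul, Nat.card_eq_fintype_card,
    Fintype.card_subtype, mul_div_left_comm]
  simp only [rankIndex_eq_iff, and_comm]

theorem pushforward_rankIndex_ugr (R : Fin (min n m + 1) → ℝ) :
    pushforward rankIndex (ugr (F := F) R) = R := by
  funext r
  have hr : (numRank F n m r : ℝ) ≠ 0 := Nat.cast_ne_zero.2 (numRank_pos r).ne'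
  rw [pushforward_eq_natCard_mul fun M hM => ugr_eq_of_rankIndex_eq hM, natCard_rankIndex_eq,
    mul_div_cancel₀ _ hr]

theorem ugr_mem_stdSimplex (hR : R ∈ rankDists n m) : ugr (F := F) R ∈ stdSimplex ℝ _ := by
  refine ⟨ugr_nonneg hR.1, ?_⟩
  have h := sum_pushforward_mul rankIndex (ugr (F := F) R) 1
  rw [pushforward_rankIndex_ugr] at h
  simpa [hR.2] using h.symm

variable [DecidableEq F]

theorem channelLaw_nonneg (hR : ∀ r, 0 ≤ R r) (X Y : Matrix (Fin n) (Fin m) F) :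
    0 ≤ channelLaw R X Y := by
  refine Finset.sum_nonneg fun A _ => Finset.sum_nonneg fun B _ => ?_
  have := ugr_nonneg hR B
  split_ifs <;> positivity

theorem channelLaw_transform (A A' : GL (Fin n) F) (φ : (Fin m → F) ≃ₗ[F] (Fin m → F))
    (X Y : Matrix (Fin n) (Fin m) F) :
    channelLaw R (transform A φ X) (transform A' φ Y) = channelLaw R X Y := by
  have hmul (G : GL (Fin n) F) (M : Matrix (Fin n) (Fin m) F) :
      (A' * G * A⁻¹).1 * transform A φ M = transform A' φ (G.1 * M) := by
    rw [mul_transform, inv_mul_cancel_right]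
    refine funext fun i => ?_
    change φ (((A' * G).1 * M) i) = φ ((A'.1 * (G.1 * M)) i)
    rw [Units.val_mul, Matrix.mul_assoc]
  unfold channelLaw
  rw [← Equiv.sum_comp ((Equiv.mulLeft A').trans (Equiv.mulRight A⁻¹))]
  refine Finset.sum_congr rfl fun G _ => ?_
  rw [← (transform A φ).bijective.sum_comp]
  refine Finset.sum_congr rfl fun B _ => ?_
  simp only [Equiv.trans_apply, Equiv.coe_mulLeft, Equiv.coe_mulRight,
    ugr_transform, ← map_add, hmul, (transform A' φ).apply_eq_iff_eq]

theorem channelLaw_eq_of_rowSpace_eq (X : Matrix (Fin n) (Fin m) F)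
    {Y Y' : Matrix (Fin n) (Fin m) F} (h : rowSpace Y = rowSpace Y') :
    channelLaw R X Y = channelLaw R X Y' := by
  obtain ⟨A, rfl⟩ := exists_transform_eq (φ := .refl F _) ((Submodule.map_id _).trans h)
  have hX : transform 1 (.refl F _) X = X := Matrix.one_mul X
  rw [← channelLaw_transform 1 A (.refl F _), hX]

theorem outputDist_ugr_eq_of_rank_eq (RX : Fin (min n m + 1) → ℝ)
    {Y Y' : Matrix (Fin n) (Fin m) F} (h : Y.rank = Y'.rank) :
    outputDist R (ugr RX) Y = outputDist R (ugr RX) Y' := by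
  obtain ⟨A, φ, rfl⟩ := exists_transform_eq_of_rank_eq h
  unfold outputDist
  rw [← (transform A φ).bijective.sum_comp fun X => _ * channelLaw R X (transform A φ Y)]
  simp only [ugr_transform, channelLaw_transform]

theorem sum_channelLaw_mul (X : Matrix (Fin n) (Fin m) F) {g : Matrix (Fin n) (Fin m) F → ℝ}
    (hg : ∀ (A : GL (Fin n) F) M, g (A.1 * M) = g M) :
    ∑ Y, channelLaw R X Y * g Y = ∑ B, ugr R B * g (X + B) := by
  have hA (A : GL (Fin n) F) :
      ∑ Y, ∑ B, 1 / (Fintype.card (GL (Fin n) F) : ℝ) * ugr R B *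
          (if A.1 * (X + B) = Y then 1 else 0) * g Y =
        1 / (Fintype.card (GL (Fin n) F) : ℝ) * ∑ B, ugr R B * g (X + B) := by
    rw [Finset.sum_comm, Finset.mul_sum]
    simp only [mul_ite, mul_one, mul_zero, ite_mul, zero_mul, Finset.sum_ite_eq, Finset.mem_univ,
      if_true, hg, mul_assoc]
  simp only [channelLaw, Finset.sum_mul]
  rw [Finset.sum_comm]
  simp only [hA, Finset.sum_const, Finset.card_univ, nsmul_eq_mul]
  rw [← mul_assoc, mul_one_div_cancel (Nat.cast_ne_zero.2 Fintype.card_ne_zero), one_mul]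

theorem pushforward_channelLaw {ι : Type*} {κ : Matrix (Fin n) (Fin m) F → ι}
    (hκ : ∀ (A : GL (Fin n) F) M, κ (A.1 * M) = κ M) (X : Matrix (Fin n) (Fin m) F) :
    pushforward κ (channelLaw R X) = pushforward (fun B => κ (X + B)) (ugr R) := by
  classical
  funext i
  simpa [pushforward, Finset.sum_filter] using
    sum_channelLaw_mul X (g := fun Y => if κ Y = i then 1 else 0) fun A M => by rw [hκ]

theorem pushforward_rowSpace_channelLaw (X : Matrix (Fin n) (Fin m) F)
    (V : Submodule F (Fin m → F)) :
    pushforward rowSpace (channelLaw R X) V =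
      rowProb F n m R X.rank (finrank F V) (quotDim (rowSpace X) V) := by
  rw [pushforward_channelLaw rowSpace_mul, pushforward_ugr, rowProb]
  simp only [← count1_eq_f1 (finrank_rowSpace X) rfl rfl, count1]

theorem pushforward_rankIndex_channelLaw (X : Matrix (Fin n) (Fin m) F)
    (r : Fin (min n m + 1)) :
    pushforward rankIndex (channelLaw R X) r =
      ∑ rB, R rB * ((f2 F n m r X.rank rB : ℝ) / numRank F n m rB) := by
  have hrank (A : GL (Fin n) F) (M : Matrix (Fin n) (Fin m) F) :
      rankIndex (A.1 * M) = rankIndex M :=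
    Fin.ext <| by
      change (A.1 * M).rank = M.rank
      rw [← finrank_rowSpace, rowSpace_mul, finrank_rowSpace]
  rw [pushforward_channelLaw hrank, pushforward_ugr]
  simp only [← count2_eq_f2 (X := X) rfl, count2, rankIndex_eq_iff]

theorem pushforward_rankIndex_outputDist (P : Matrix (Fin n) (Fin m) F → ℝ)
    (r : Fin (min n m + 1)) :
    pushforward rankIndex (outputDist R P) r = outRank F n m R (pushforward rankIndex P) r :=
  calc pushforward rankIndex (outputDist R P) r
      = ∑ X, P X * pushforward rankIndex (channelLaw R X) r := by
        simp only [pushforward, outputDist, Finset.mul_sum]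
        exact Finset.sum_comm
    _ = ∑ X, P X * ∑ rB, R rB * ((f2 F n m r (rankIndex X) rB : ℝ) / numRank F n m rB) := by
        simp only [pushforward_rankIndex_channelLaw, rankIndex]
    _ = outRank F n m R (pushforward rankIndex P) r := by
        rw [← sum_pushforward_mul rankIndex P fun rX =>
          ∑ rB, R rB * ((f2 F n m r rX rB : ℝ) / numRank F n m rB)]
        simp only [outRank, Finset.mul_sum, mul_assoc]

end Channel

section Capacity

variable {F : Type*} [Field F] [Fintype F] {n m : ℕ} {R : Fin (min n m + 1) → ℝ}

variable (F n m) in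
/-- The conditional entropy of the output of the channel, given that the input is some fixed
matrix of rank `r`: the inner double sum of `objective`. -/
def condEntropy (b : ℝ) (R : Fin (min n m + 1) → ℝ) (r : ℕ) : ℝ :=
  ∑ u ∈ Finset.range (min n m + 1), ∑ h ∈ Finset.range (r + 1),
    (Fintype.card F : ℝ) ^ (((u : ℤ) - r + h) * h) *
      gaussBinom (Fintype.card F) (m - r) ((u : ℤ) - r + h) *
      gaussBinom (Fintype.card F) r ((r : ℤ) - h) *
      (rowProb F n m R r u h * Real.logb b ((f0 F n m u : ℝ) / rowProb F n m R r u h))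

theorem objective_eq (b : ℝ) (R RX : Fin (min n m + 1) → ℝ) :
    objective F n m b R RX =
      ∑ r : Fin (min n m + 1), outRank F n m R RX r *
        Real.logb b (numRank F n m r / outRank F n m R RX r) -
      ∑ r : Fin (min n m + 1), RX r * condEntropy F n m b R r := by
  rw [objective, Finset.sum_range, ← Finset.sum_neg_distrib]
  simp only [one_div_mul_eq_div, ← mul_neg, ← Real.logb_inv, inv_div]
  rfl

theorem continuous_mul_logb_const_mul (b : ℝ) {c : ℝ} (hc : c ≠ 0) :
    Continuous fun x => x * Real.logb b (c * x) := by
  have h (x : ℝ) : x * Real.logb b (c * x) = c⁻¹ * ((c * x) * Real.log (c * x)) / Real.log b := by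
    rw [Real.logb, mul_assoc c, inv_mul_cancel_left₀ hc, mul_div_assoc]
  simp only [h]
  exact (continuous_const.mul
    (Real.continuous_mul_log.comp (continuous_const.mul continuous_id))).div_const _

theorem continuous_objective (b : ℝ) (R : Fin (min n m + 1) → ℝ) :
    Continuous (objective F n m b R) := by
  unfold objective
  refine (continuous_finsetSum _ fun r hr => ?_).neg.sub (by fun_prop)
  have hout : Continuous fun RX => outRank F n m R RX r := by
    unfold outRank
    fun_prop
  have hpos := numRank_pos (F := F) ⟨r, Finset.mem_range.1 hr⟩
  exact (continuous_mul_logb_const_mul b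
    (one_div_ne_zero (Nat.cast_ne_zero.2 hpos.ne'))).comp hout

variable [DecidableEq F]

theorem entropy_channelLaw (b : ℝ) (X : Matrix (Fin n) (Fin m) F) :
    entropy b (channelLaw R X) = condEntropy F n m b R X.rank := by
  have : Fintype (Submodule F (Fin m → F)) := Fintype.ofFinite _
  let κ (V : Submodule F (Fin m → F)) : ℕ × ℕ := (finrank F V, quotDim (rowSpace X) V)
  let g (i : ℕ × ℕ) : ℝ := rowProb F n m R X.rank i.1 i.2 *
    Real.logb b (f0 F n m i.1 / rowProb F n m R X.rank i.1 i.2)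
  let s := Finset.range (min n m + 1) ×ˢ Finset.range (X.rank + 1)
  have hg (V) (hV : κ V ∉ s) : g (κ V) = 0 := by
    have hrow (Y : Matrix (Fin n) (Fin m) F) : rowSpace Y ≠ V := by
      rintro rfl
      have hY := rank_lt Y
      have hdim := quotDim_add_finrank_inf (rowSpace X) (rowSpace Y)
      rw [finrank_rowSpace] at hdim
      refine hV (Finset.mem_product.2 ⟨Finset.mem_range.2 ?_, Finset.mem_range.2 ?_⟩)
      · exact (finrank_rowSpace Y).trans_lt hY
      · change quotDim (rowSpace X) (rowSpace Y) < X.rank + 1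
        lia
    have hzero : rowProb F n m R X.rank (κ V).1 (κ V).2 = 0 := by
      rw [← pushforward_rowSpace_channelLaw, pushforward]
      exact Finset.sum_eq_zero fun Y hY => absurd (Finset.mem_filter.1 hY).2 (hrow Y)
    exact mul_eq_zero_of_left hzero _
  calc entropy b (channelLaw R X)
      = ∑ V, pushforward rowSpace (channelLaw R X) V *
          Real.logb b (count0 F n m V / pushforward rowSpace (channelLaw R X) V) :=
        entropy_eq_sum_pushforward b fun _ _ => channelLaw_eq_of_rowSpace_eq X
    _ = ∑ V, g (κ V) := by simp only [pushforward_rowSpace_channelLaw, count0_eq_f0 rfl, g, κ]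
    _ = ∑ i ∈ s, (Nat.card {V // κ V = i} : ℝ) * g i := sum_comp_eq_sum_natCard_mul κ s g hg
    _ = condEntropy F n m b R X.rank := by
        rw [Finset.sum_product, condEntropy]
        refine Finset.sum_congr rfl fun u _ => Finset.sum_congr rfl fun h hh => ?_
        simp only [κ, Prod.mk.injEq]
        rw [natCard_submodule_quotDim (finrank_rowSpace X) u
          (Nat.lt_succ_iff.1 (Finset.mem_range.1 hh))]

theorem mutualInfo_eq (b : ℝ) (hR : ∀ r, 0 ≤ R r) {P : Matrix (Fin n) (Fin m) F → ℝ}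
    (hP : ∀ X, 0 ≤ P X) :
    mutualInfo b R P = entropy b (outputDist R P) -
      ∑ r : Fin (min n m + 1), pushforward rankIndex P r * condEntropy F n m b R r := by
  refine (sum_mul_logb_div_eq_entropy_sub b hP (channelLaw_nonneg hR)).trans ?_
  rw [sum_pushforward_mul rankIndex P fun r => condEntropy F n m b R r]
  simp only [entropy_channelLaw]
  rfl

theorem mutualInfo_le_objective {b : ℝ} (hb : 1 < b) (hR : ∀ r, 0 ≤ R r)
    {P : Matrix (Fin n) (Fin m) F → ℝ} (hP : ∀ X, 0 ≤ P X) :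
    mutualInfo b R P ≤ objective F n m b R (pushforward rankIndex P) := by
  have hout (Y) : 0 ≤ outputDist R P Y :=
    Finset.sum_nonneg fun X _ => mul_nonneg (hP X) (channelLaw_nonneg hR X Y)
  have h := entropy_le_sum_pushforward rankIndex hb hout
  simp only [pushforward_rankIndex_outputDist, natCard_rankIndex_eq] at h
  rw [mutualInfo_eq b hR hP, objective_eq]
  exact sub_le_sub_right h _

theorem mutualInfo_ugr (b : ℝ) (hR : ∀ r, 0 ≤ R r) {RX : Fin (min n m + 1) → ℝ}
    (hRX : ∀ r, 0 ≤ RX r) :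
    mutualInfo (F := F) b R (ugr RX) = objective F n m b R RX := by
  have h := entropy_eq_sum_pushforward (κ := rankIndex (F := F)) b fun _ _ hY =>
    outputDist_ugr_eq_of_rank_eq (R := R) RX (Fin.ext_iff.1 hY)
  simp only [pushforward_rankIndex_outputDist, natCard_rankIndex_eq,
    pushforward_rankIndex_ugr] at h
  rw [mutualInfo_eq b hR (ugr_nonneg hRX), objective_eq, h, pushforward_rankIndex_ugr]

theorem exists_isGreatest_mutualInfoValues_objective {b : ℝ} (hb : 1 < b)
    (hR : R ∈ rankDists n m) :
    ∃ C, IsGreatest (mutualInfoValues F n m b R) C ∧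
      IsGreatest (objective F n m b R '' rankDists n m) C := by
  obtain ⟨RX, hRX, hmax⟩ := (isCompact_stdSimplex ℝ (Fin (min n m + 1))).exists_isMaxOn ⟨R, hR⟩
    (continuous_objective (F := F) b R).continuousOn
  refine ⟨objective F n m b R RX, ⟨⟨ugr RX, ugr_mem_stdSimplex hRX, mutualInfo_ugr b hR.1 hRX.1⟩,
    ?_⟩, ⟨RX, hRX, rfl⟩, ?_⟩
  · rintro _ ⟨P, hP, rfl⟩
    exact (mutualInfo_le_objective hb hR.1 hP.1).trans
      (hmax (pushforward_mem_stdSimplex rankIndex hP))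
  · rintro _ ⟨RX', hRX', rfl⟩
    exact hmax hRX'

end Capacity

end GammaChannel

end

theorem corollary6p2 (F : Type*) [Field F] [Fintype F] [DecidableEq F] (n m : ℕ)
    (b : ℝ) (hb : 1 < b)
    (R : Fin (min n m + 1) → ℝ) (hR : R ∈ GammaChannel.rankDists n m) :
    -- the counting functions do not depend on the chosen subspaces and matrices
    (∀ (u : ℕ) (U : Submodule F (Fin m → F)), Module.finrank F U = u →
      GammaChannel.count0 F n m U = GammaChannel.f0 F n m u) ∧
    (∀ (u v h r : ℕ) (M : Matrix (Fin n) (Fin m) F) (V : Submodule F (Fin m → F)),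
      Module.finrank F (GammaChannel.rowSpace M) = u → Module.finrank F V = v →
      GammaChannel.quotDim (GammaChannel.rowSpace M) V = h →
      GammaChannel.count1 F n m M V r = GammaChannel.f1 F n m u v h r) ∧
    (∀ (r rX rB : ℕ) (X : Matrix (Fin n) (Fin m) F), X.rank = rX →
      GammaChannel.count2 F n m X r rB = GammaChannel.f2 F n m r rX rB) ∧
    -- the capacity is the maximum of the mutual information over all input distributions
    IsGreatest (GammaChannel.mutualInfoValues F n m b R) (GammaChannel.capacity F n m b R) ∧
    -- the capacity is the maximum of the objective over all input rank distributions
    IsGreatest (GammaChannel.objective F n m b R '' GammaChannel.rankDists n m)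
      (GammaChannel.capacity F n m b R) := by
  obtain ⟨C, hC, hC'⟩ :=
    GammaChannel.exists_isGreatest_mutualInfoValues_objective (F := F) hb hR
  obtain rfl : GammaChannel.capacity F n m b R = C := hC.csSup_eq
  exact ⟨fun _ _ => GammaChannel.count0_eq_f0, fun _ _ _ _ _ _ => GammaChannel.count1_eq_f1,
    fun _ _ _ _ => GammaChannel.count2_eq_f2, hC, hC'⟩
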